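/- For integrable $\psi:\mathbb R^d\to\mathbb C$ write $\widehat\psi(\xi)=\int_{\mathbb R^d}\psi(x)e^{-2\pi i x\cdot\xi}\,dx$, and for $s>0$, $t\in\mathbb R^d$ let $\psi_{s,t}(x)=s^{-d/2}\psi\big(\frac{x-t}{s}\big)$. The wavelet transform of $f:\mathbb R^d\to\mathbb C$ is $(W_\psi f)(s,t)=\int_{\mathbb R^d}f(x)\overline{\psi_{s,t}(x)}\,dx$. A function $\lambda$ on $\mathbb R^d$ is called nontrivial in direction $\xi$ (where $|\xi|=1$) if the set $\{r>0:\lambda(r\xi)\neq0\}$ has positive Lebesgue measure. Theorem. Let $k\ge 0$ be an integer. Assume $f:\mathbb R^d\to\mathbb C$ is locally integrable with $f(x)(1+|x|)^{-k}\in L^\infty(\mathbb R^d)$. Assume $\psi:\mathbb R^d\to\mathbb C$ is integrable with $\psi(x)(1+|x|)^k\in L^1(\mathbb R^d)$ and $\widehat\psi\in C^\infty(\mathbb R^d\setminus\{0\})$, and suppose that $(W_\psi f)(s,t)=0$ for all $s>0$ and $t\in\mathbb R^d$. If $\widehat\psi$ is nontrivial in every direction, i.e. in direction $\xi$ for every unit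 vector $\xi$, then $f$ is equal almost everywhere to a polynomial of (total) degree at most $k$. In particular, if $f$ is bounded ($f\in L^\infty(\mathbb R^d)$), then $f$ is equal almost everywhere to a constant. -/

import Mathlib

open MeasureTheory
open scoped FourierTransform ContDiff ENNReal ComplexConjugate

noncomputable section

/-- The rescaled and translated wavelet `ψ_{s,t}(x) = s^{-d/2} ψ((x - t) / s)`. -/
def waveletDilate {d : ℕ} (ψ : EuclideanSpace ℝ (Fin d) → ℂ) (s : ℝ)
    (t x : EuclideanSpace ℝ (Fin d)) : ℂ :=
  ((1 / s ^ ((d : ℝ) / 2) : ℝ) : ℂ) * ψ (s⁻¹ • (x - t))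

/-- The continuous wavelet transform `(W_ψ f)(s,t) = ∫ f(x) conj (ψ_{s,t}(x)) dx`,
used for `s > 0`. -/
def waveletTransform {d : ℕ} (ψ f : EuclideanSpace ℝ (Fin d) → ℂ) (s : ℝ)
    (t : EuclideanSpace ℝ (Fin d)) : ℂ :=
  ∫ x, f x * conj (waveletDilate ψ s t x)

/-- `g` is nontrivial in the direction `ξ` (a unit vector): the set of radii `r > 0` with
`g (r ξ) ≠ 0` has positive Lebesgue measure. -/
def NontrivialInDirection {d : ℕ} (g : EuclideanSpace ℝ (Fin d) → ℂ)
    (ξ : EuclideanSpace ℝ (Fin d)) : Prop :=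
  0 < volume {r : ℝ | 0 < r ∧ g (r • ξ) ≠ 0}

end

/-! The vanishing of the wavelet transform confines the Fourier transform of `f` to the origin, and
polynomial growth then makes `f` a polynomial.

Localisation: rescaling gives `∫ f(t + s y) conj (ψ y) dy = 0`. Integrating against `𝓕 h` and
applying Fubini (`integral_shear`) yields `∫ f · 𝓕(h · conj (𝓕 ψ (s ·))) = 0` for every Schwartz
`h`. On a compact set missing `0`, finitely many dilates of `𝓕 ψ` have no common zero, so a test
function `g` supported there is a finite sum of such products. Hence `∫ f · 𝓕 g = 0`
(`integral_mul_fourier_eq_zero_of_notMem_tsupport`).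

Rigidity: let `φ = 𝓕⁻ χ` with `χ = 1` near `0`. The mollification `F(x) = ∫ f(x - R y) φ(y) dy` is
independent of `R > 0`, since changing `R` alters the test function only away from the origin
(`integral_mollify_eq`). As `R → 0` it recovers `f` almost everywhere (`ae_eq_mollification`). As `R
→ ∞`, Taylor expansion of `φ` shows that `F` is a pointwise limit of polynomials of degree at most
`k` (`mollification_mem_polyFunctions`). These form a finite-dimensional, hence closed, space. -/

lemma one_add_norm_add_le {E : Type*} [SeminormedAddCommGroup E] (x y : E) : 1 + ‖x + y‖ ≤ (1 + ‖x‖) * (1 + ‖y‖) := by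
  nlinarith [norm_add_le x y, norm_nonneg x, norm_nonneg y, mul_nonneg (norm_nonneg x) (norm_nonneg y)]

lemma one_add_norm_smul_le {E : Type*} [SeminormedAddCommGroup E] [NormedSpace ℝ E] (s : ℝ) (y : E) : 1 + ‖s • y‖ ≤ max 1 |s| * (1 + ‖y‖) := by
  rw [norm_smul, Real.norm_eq_abs]
  nlinarith [le_max_left 1 |s|, le_max_right 1 |s|, norm_nonneg y,
    mul_le_mul_of_nonneg_right (le_max_right 1 |s|) (norm_nonneg y)]

lemma SchwartzMap.exists_weighted_bound {E F : Type*} [NormedAddCommGroup E]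
    [NormedSpace ℝ E] [NormedAddCommGroup F] [NormedSpace ℝ F]
    (φ : SchwartzMap E F) (n j : ℕ) :
    ∃ C, 0 ≤ C ∧ ∀ x, (1 + ‖x‖) ^ n * ‖iteratedFDeriv ℝ j φ x‖ ≤ C :=
  ⟨_, by positivity, fun x =>
    SchwartzMap.one_add_le_sup_seminorm_apply (𝕜 := ℝ) (m := (n, j)) le_rfl le_rfl φ x⟩

/-! ### Fubini and integrability under polynomial growth. -/

section Growth

variable {E : Type*} [NormedAddCommGroup E] [InnerProductSpace ℝ E] [FiniteDimensional ℝ E]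
  [MeasurableSpace E] [BorelSpace E]

lemma measurePreserving_shear (s : ℝ) :
    MeasurePreserving (fun p : E × E => (p.1 + s • p.2, p.2))
      (volume.prod volume) (volume.prod volume) := by
  have h : MeasurePreserving (fun p : E × E => (p.1, p.2 + s • p.1))
      (volume.prod volume) (volume.prod volume) :=
    (MeasurePreserving.id (volume : Measure E)).skew_product
      (g := fun x y => y + s • x) (by fun_prop)
      (Filter.Eventually.of_forall fun x => (measurePreserving_add_right volume (s • x)).map_eq)
  exact (Measure.measurePreserving_swap.comp h).comp Measure.measurePreserving_swap

lemma integrable_shear {f a b : E → ℂ} {C : ℝ} {k : ℕ} (hfm : AEStronglyMeasurable f volume)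
    (hf : ∀ᵐ x, ‖f x‖ ≤ C * (1 + ‖x‖) ^ k) (ham : AEStronglyMeasurable a volume)
    (hbm : AEStronglyMeasurable b volume)
    (ha : Integrable (fun x => (1 + ‖x‖) ^ k * ‖a x‖))
    (hb : Integrable (fun x => (1 + ‖x‖) ^ k * ‖b x‖)) (s : ℝ) :
    Integrable (fun p : E × E => f (p.1 + s • p.2) * (a p.1 * b p.2)) (volume.prod volume) := by
  have hq := (measurePreserving_shear (E := E) s).quasiMeasurePreserving
  have hq1 := (Measure.quasiMeasurePreserving_fst (μ := (volume : Measure E))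
    (ν := (volume : Measure E))).comp hq
  refine ((ha.mul_prod hb).const_mul (|C| * (max 1 |s|) ^ k)).mono'
    ((hfm.comp_quasiMeasurePreserving hq1).mul
      ((ham.comp_quasiMeasurePreserving Measure.quasiMeasurePreserving_fst).mul
        (hbm.comp_quasiMeasurePreserving Measure.quasiMeasurePreserving_snd))) ?_
  filter_upwards [hq1.ae hf] with p hp
  simp only [Function.comp_apply] at hp
  have h1 : (1 + ‖p.1 + s • p.2‖) ^ k
      ≤ (1 + ‖p.1‖) ^ k * (max 1 |s| ^ k * (1 + ‖p.2‖) ^ k) := by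
    rw [← mul_pow, ← mul_pow]
    refine pow_le_pow_left₀ (by positivity) ((one_add_norm_add_le _ _).trans ?_) _
    gcongr
    exact one_add_norm_smul_le s p.2
  rw [norm_mul, norm_mul]
  calc ‖f (p.1 + s • p.2)‖ * (‖a p.1‖ * ‖b p.2‖)
      ≤ (|C| * ((1 + ‖p.1‖) ^ k * (max 1 |s| ^ k * (1 + ‖p.2‖) ^ k))) * (‖a p.1‖ * ‖b p.2‖) := by
        gcongr
        refine hp.trans ?_
        gcongr
        exact le_abs_self C
    _ = _ := by ring

lemma integrable_shear' {f a b : E → ℂ} {C : ℝ} {k : ℕ} (hfm : AEStronglyMeasurable f volume)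
    (hf : ∀ᵐ x, ‖f x‖ ≤ C * (1 + ‖x‖) ^ k) (ham : AEStronglyMeasurable a volume)
    (hbm : AEStronglyMeasurable b volume)
    (ha : Integrable (fun x => (1 + ‖x‖) ^ k * ‖a x‖))
    (hb : Integrable (fun x => (1 + ‖x‖) ^ k * ‖b x‖)) (s : ℝ) :
    Integrable (fun p : E × E => f p.1 * (a (p.1 - s • p.2) * b p.2)) (volume.prod volume) := by
  have := (measurePreserving_shear (E := E) (-s)).integrable_comp_of_integrable
    (integrable_shear hfm hf ham hbm ha hb s)
  refine this.congr (Filter.Eventually.of_forall fun p => ?_)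
  simp [sub_eq_add_neg]

/-- Fubini and the translation `x = z + s • y` move the dilated shift from `a` to `f`. It serves
twice: for the wavelet (`b = conj ψ`) and, with `s = -R`, for the mollification (`b = φ`). -/
lemma integral_shear {f a b : E → ℂ} {C : ℝ} {k : ℕ} (hfm : AEStronglyMeasurable f volume)
    (hf : ∀ᵐ x, ‖f x‖ ≤ C * (1 + ‖x‖) ^ k) (ham : AEStronglyMeasurable a volume)
    (hbm : AEStronglyMeasurable b volume)
    (ha : Integrable (fun x => (1 + ‖x‖) ^ k * ‖a x‖))
    (hb : Integrable (fun x => (1 + ‖x‖) ^ k * ‖b x‖)) (s : ℝ) :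
    ∫ x, f x * ∫ y, a (x - s • y) * b y = ∫ z, a z * ∫ y, f (z + s • y) * b y := by
  have hi := integrable_shear hfm hf ham hbm ha hb s
  have hi2 := integrable_shear' hfm hf ham hbm ha hb s
  calc ∫ x, f x * ∫ y, a (x - s • y) * b y
      = ∫ x, ∫ y, f x * (a (x - s • y) * b y) := by simp_rw [integral_const_mul]
    _ = ∫ y, ∫ x, f x * (a (x - s • y) * b y) := integral_integral_swap hi2
    _ = ∫ y, ∫ z, f (z + s • y) * (a z * b y) := by
        congr 1 with y
        rw [← integral_add_right_eq_self _ (s • y)]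
        simp
    _ = ∫ z, ∫ y, f (z + s • y) * (a z * b y) := (integral_integral_swap hi).symm
    _ = _ := by
        congr 1 with z
        rw [← integral_const_mul]
        congr 1 with y
        ring

lemma integrable_inv_one_add_norm_pow :
    Integrable (fun x : E => ((1 + ‖x‖) ^ (Module.finrank ℝ E + 1))⁻¹) := by
  have := integrable_one_add_norm (E := E) (μ := volume) (r := (Module.finrank ℝ E + 1 : ℕ))
    (by push_cast; linarith)
  refine this.congr (Filter.Eventually.of_forall fun x => ?_)
  simp only
  rw [Real.rpow_neg (by positivity), Real.rpow_natCast]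

lemma SchwartzMap.integrable_weighted_iteratedFDeriv {F : Type*} [NormedAddCommGroup F]
    [NormedSpace ℝ F] (φ : SchwartzMap E F) (n j : ℕ) :
    Integrable (fun x => (1 + ‖x‖) ^ n * ‖iteratedFDeriv ℝ j φ x‖) := by
  obtain ⟨C, -, hC⟩ := φ.exists_weighted_bound (n + (Module.finrank ℝ E + 1)) j
  refine (integrable_inv_one_add_norm_pow.const_mul C).mono' ?_
    (Filter.Eventually.of_forall fun x => ?_)
  · have : Continuous (iteratedFDeriv ℝ j φ) :=
      (φ.smooth j).continuous_iteratedFDeriv le_rfl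
    exact (by fun_prop : Continuous _).aestronglyMeasurable
  · rw [Real.norm_of_nonneg (by positivity), ← div_eq_mul_inv, le_div_iff₀ (by positivity)]
    refine le_trans (le_of_eq ?_) (hC x)
    ring

lemma SchwartzMap.integrable_weighted {F : Type*} [NormedAddCommGroup F]
    [NormedSpace ℝ F] (φ : SchwartzMap E F) (n : ℕ) :
    Integrable (fun x => (1 + ‖x‖) ^ n * ‖φ x‖) := by
  simpa using φ.integrable_weighted_iteratedFDeriv n 0

lemma integrable_mul_of_growth {f a : E → ℂ} {C : ℝ} {k : ℕ}
    (hfm : AEStronglyMeasurable f volume)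
    (hf : ∀ᵐ x, ‖f x‖ ≤ C * (1 + ‖x‖) ^ k) (ham : AEStronglyMeasurable a volume)
    (ha : Integrable (fun x => (1 + ‖x‖) ^ k * ‖a x‖)) :
    Integrable (fun x => f x * a x) := by
  refine (ha.const_mul C).mono' (hfm.mul ham) ?_
  filter_upwards [hf] with x hx
  rw [norm_mul, ← mul_assoc]
  gcongr

end Growth

/-! ### Fourier transform of a product with a dilated transform. -/

section FourierProduct

variable {E : Type*} [NormedAddCommGroup E] [InnerProductSpace ℝ E] [FiniteDimensional ℝ E]
  [MeasurableSpace E] [BorelSpace E]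

lemma fourier_mul_conj_fourier_dilate {h ψ : E → ℂ} (hh : Integrable h) (hψ : Integrable ψ)
    (s : ℝ) (x : E) :
    𝓕 (fun ξ => h ξ * conj (𝓕 ψ (s • ξ))) x = ∫ y, 𝓕 h (x - s • y) * conj (ψ y) := by
  have hkey : ∀ ξ y : E, Real.fourierChar (-inner ℝ ξ x) •
      (h ξ * conj (Real.fourierChar (-inner ℝ y (s • ξ)) • ψ y))
      = (Real.fourierChar (-inner ℝ ξ (x - s • y)) • h ξ) * conj (ψ y) := by
    intro ξ y
    simp only [Circle.smul_def, smul_eq_mul, map_mul, ← Circle.coe_inv_eq_conj,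
      ← AddChar.map_neg_eq_inv]
    have : Real.fourierChar (-inner ℝ ξ (x - s • y))
        = Real.fourierChar (-inner ℝ ξ x) * Real.fourierChar (- -inner ℝ y (s • ξ)) := by
      rw [← AddChar.map_add_eq_mul]
      congr 1
      rw [inner_sub_right, inner_smul_right, inner_smul_right, real_inner_comm ξ y]
      ring
    rw [this, Circle.coe_mul]
    ring
  have hint : Integrable (fun p : E × E =>
      (Real.fourierChar (-inner ℝ p.1 (x - s • p.2)) • h p.1) * conj (ψ p.2))
      (volume.prod volume) := by
    have h0 := hh.mul_prod (Complex.conjCLE.toContinuousLinearMap.integrable_comp hψ)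
    have hc : Continuous fun p : E × E => Real.fourierChar (-inner ℝ p.1 (x - s • p.2)) := by
      fun_prop
    refine h0.mono ?_ (Filter.Eventually.of_forall fun p => by simp)
    have := hc.aestronglyMeasurable (μ := (volume : Measure E).prod volume) |>.smul
      h0.aestronglyMeasurable
    refine this.congr (Filter.Eventually.of_forall fun p => ?_)
    simp [Circle.smul_def, mul_assoc]
  calc 𝓕 (fun ξ => h ξ * conj (𝓕 ψ (s • ξ))) x
      = ∫ ξ, ∫ y, (Real.fourierChar (-inner ℝ ξ (x - s • y)) • h ξ) * conj (ψ y) := by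
        rw [Real.fourier_eq]
        congr 1 with ξ
        rw [Real.fourier_eq, ← integral_conj, ← integral_const_mul, Circle.smul_def, ← integral_smul]
        simp_rw [← Circle.smul_def, hkey]
    _ = ∫ y, ∫ ξ, (Real.fourierChar (-inner ℝ ξ (x - s • y)) • h ξ) * conj (ψ y) :=
        integral_integral_swap hint
    _ = _ := by
        congr 1 with y
        rw [integral_mul_const, Real.fourier_eq]

end FourierProduct

/-! ### Vanishing of the Fourier transform of `f` away from the origin. -/

section Wavelet

variable {d : ℕ}

lemma integral_dilate_of_waveletTransform_eq_zero {f ψ : EuclideanSpace ℝ (Fin d) → ℂ} {s : ℝ}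
    (hs : 0 < s) {t : EuclideanSpace ℝ (Fin d)} (hW : waveletTransform ψ f s t = 0) :
    ∫ y, f (t + s • y) * conj (ψ y) = 0 := by
  have hc : ((1 / s ^ ((d : ℝ) / 2) : ℝ) : ℂ) ≠ 0 := by
    rw [Complex.ofReal_ne_zero]
    exact (one_div_pos.2 (Real.rpow_pos_of_pos hs _)).ne'
  have h1 : ∫ x, f x * conj (ψ (s⁻¹ • (x - t))) = 0 := by
    have : waveletTransform ψ f s t = ((1 / s ^ ((d : ℝ) / 2) : ℝ) : ℂ) *
        ∫ x, f x * conj (ψ (s⁻¹ • (x - t))) := by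
      rw [waveletTransform, ← integral_const_mul]
      congr 1 with x
      rw [waveletDilate, map_mul, Complex.conj_ofReal]
      ring
    rw [hW] at this
    exact (mul_eq_zero.1 this.symm).resolve_left hc
  -- Substituting `x = t + s • y` produces a Jacobian factor, which is harmless because the integral
  -- is zero.
  have h2 := Measure.integral_comp_smul (volume : Measure (EuclideanSpace ℝ (Fin d)))
    (fun w => f (t + w) * conj (ψ (s⁻¹ • w))) s
  have h3 := integral_add_left_eq_self (μ := (volume : Measure (EuclideanSpace ℝ (Fin d))))
    (fun x => f x * conj (ψ (s⁻¹ • (x - t)))) t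
  simp only [add_sub_cancel_left] at h3
  rw [h3, h1, smul_zero] at h2
  simpa [smul_smul, inv_mul_cancel₀ hs.ne'] using h2

variable {f ψ : EuclideanSpace ℝ (Fin d) → ℂ} {C : ℝ} {k : ℕ}

lemma integral_mul_fourier_mul_conj_eq_zero (hfm : AEStronglyMeasurable f volume)
    (hf : ∀ᵐ x, ‖f x‖ ≤ C * (1 + ‖x‖) ^ k) (hψ : Integrable ψ)
    (hψk : Integrable fun x => (1 + ‖x‖) ^ k * ‖ψ x‖) {s : ℝ} (hs : 0 < s)
    (hW : ∀ t, waveletTransform ψ f s t = 0) (h : SchwartzMap (EuclideanSpace ℝ (Fin d)) ℂ) :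
    ∫ x, f x * 𝓕 (fun ξ => h ξ * conj (𝓕 ψ (s • ξ))) x = 0 := by
  simp_rw [fourier_mul_conj_fourier_dilate h.integrable hψ s]
  have := integral_shear hfm hf (𝓕 h).continuous.aestronglyMeasurable
    (Complex.continuous_conj.comp_aestronglyMeasurable hψ.aestronglyMeasurable)
    ((𝓕 h).integrable_weighted k) (by simpa using hψk) s
  simp only [SchwartzMap.fourier_coe] at this
  rw [this]
  simp [integral_dilate_of_waveletTransform_eq_zero hs (hW _)]

lemma NontrivialInDirection.exists_pos {g : EuclideanSpace ℝ (Fin d) → ℂ}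
    {ξ : EuclideanSpace ℝ (Fin d)} (hξ : ξ ≠ 0) (hg : NontrivialInDirection g (‖ξ‖⁻¹ • ξ)) :
    ∃ s : ℝ, 0 < s ∧ g (s • ξ) ≠ 0 := by
  obtain ⟨r, hr, hgr⟩ := nonempty_of_measure_ne_zero hg.ne'
  exact ⟨r * ‖ξ‖⁻¹, mul_pos hr (inv_pos.2 (norm_pos_iff.2 hξ)), by rwa [mul_smul]⟩

/-- Each ray has a radius where `Ψ` is nonzero, continuity spreads this to an open set of directions
and radii, and compactness leaves finitely many dilations. -/
lemma exists_finset_dilates_ne_zero {Ψ : EuclideanSpace ℝ (Fin d) → ℂ} (hΨ : Continuous Ψ)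
    (hnt : ∀ ξ, ‖ξ‖ = 1 → NontrivialInDirection Ψ ξ) {K : Set (EuclideanSpace ℝ (Fin d))}
    (hK : IsCompact K) (h0 : (0 : EuclideanSpace ℝ (Fin d)) ∉ K) :
    ∃ t : Finset {s : ℝ // 0 < s}, ∀ ξ ∈ K, ∃ s ∈ t, Ψ (s.1 • ξ) ≠ 0 := by
  obtain ⟨t, ht⟩ := hK.elim_finite_subcover (fun s : {s : ℝ // 0 < s} => {ξ | Ψ (s.1 • ξ) ≠ 0})
    (fun s => isOpen_ne_fun (by fun_prop) continuous_const) (by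
      intro ξ hξ
      have hξ0 : ξ ≠ 0 := fun h => h0 (h ▸ hξ)
      obtain ⟨s, hs, h⟩ := (hnt (‖ξ‖⁻¹ • ξ) (by
        rw [norm_smul, norm_inv, norm_norm, inv_mul_cancel₀ (norm_ne_zero_iff.2 hξ0)])).exists_pos
        hξ0
      exact Set.mem_iUnion.2 ⟨⟨s, hs⟩, h⟩)
  refine ⟨t, fun ξ hξ => ?_⟩
  obtain ⟨s, hs, h⟩ := Set.mem_iUnion₂.1 (ht hξ)
  exact ⟨s, hs, h⟩

/-- The Fourier transform of `f` vanishes away from the origin. -/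
lemma integral_mul_fourier_eq_zero_of_notMem_tsupport (hfm : AEStronglyMeasurable f volume)
    (hf : ∀ᵐ x, ‖f x‖ ≤ C * (1 + ‖x‖) ^ k) (hψ : Integrable ψ)
    (hψk : Integrable fun x => (1 + ‖x‖) ^ k * ‖ψ x‖)
    (hsm : ContDiffOn ℝ ∞ (𝓕 ψ) {0}ᶜ)
    (hnt : ∀ ξ, ‖ξ‖ = 1 → NontrivialInDirection (𝓕 ψ) ξ)
    (hW : ∀ s : ℝ, 0 < s → ∀ t, waveletTransform ψ f s t = 0)
    {g : EuclideanSpace ℝ (Fin d) → ℂ} (hg : ContDiff ℝ ∞ g) (hgc : HasCompactSupport g)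
    (hg0 : (0 : EuclideanSpace ℝ (Fin d)) ∉ tsupport g) :
    ∫ x, f x * 𝓕 g x = 0 := by
  have hΨc : Continuous (𝓕 ψ) := VectorFourier.fourierIntegral_continuous
    Real.continuous_fourierChar (by exact continuous_inner) hψ
  obtain ⟨t, ht⟩ := exists_finset_dilates_ne_zero hΨc hnt hgc hg0
  -- `G = ∑ |𝓕 ψ (s ξ)|²` is smooth and positive on the support of `g`. Dividing by it gives `g = ∑
  -- h_s · conj (𝓕 ψ (s ·))` with `h_s = g · 𝓕 ψ (s ·) / G`.
  set G : EuclideanSpace ℝ (Fin d) → ℂ := fun ξ =>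
    ∑ s ∈ t, 𝓕 ψ (s.1 • ξ) * conj (𝓕 ψ (s.1 • ξ)) with hG
  have hGne : ∀ ξ ∈ tsupport g, G ξ ≠ 0 := by
    intro ξ hξ
    obtain ⟨s, hs, h⟩ := ht ξ hξ
    have : G ξ = ((∑ s ∈ t, Complex.normSq (𝓕 ψ (s.1 • ξ)) : ℝ) : ℂ) := by
      simp [hG, Complex.mul_conj]
    rw [this, Complex.ofReal_ne_zero]
    exact (Finset.sum_pos' (f := fun s : {s : ℝ // 0 < s} => Complex.normSq (𝓕 ψ (s.1 • ξ)))
      (fun i _ => Complex.normSq_nonneg _) ⟨s, hs, Complex.normSq_pos.2 h⟩).ne'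
  have hΨs : ∀ s : {s : ℝ // 0 < s}, ∀ ξ ∈ tsupport g,
      ContDiffAt ℝ ∞ (fun ξ => 𝓕 ψ (s.1 • ξ)) ξ := by
    intro s ξ hξ
    have hξ0 : s.1 • ξ ≠ 0 := smul_ne_zero s.2.ne' fun h => hg0 (h ▸ hξ)
    have h1 : ContDiffAt ℝ ∞ (𝓕 ψ) (s.1 • ξ) :=
      hsm.contDiffAt (isOpen_compl_singleton.mem_nhds hξ0)
    exact h1.comp ξ (contDiff_const_smul s.1).contDiffAt
  have hconj : ∀ s : {s : ℝ // 0 < s}, ∀ ξ ∈ tsupport g,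
      ContDiffAt ℝ ∞ (fun ξ => conj (𝓕 ψ (s.1 • ξ))) ξ := fun s ξ hξ =>
    Complex.conjCLE.contDiff.contDiffAt.comp ξ (hΨs s ξ hξ)
  have hGs : ∀ ξ ∈ tsupport g, ContDiffAt ℝ ∞ G ξ := fun ξ hξ =>
    ContDiffAt.sum fun s _ => (hΨs s ξ hξ).mul (hconj s ξ hξ)
  -- The cofactor need only be smooth on `tsupport g`: elsewhere the product is locally zero, which
  -- avoids the singularity of `𝓕 ψ` at `0` and the zeros of `G`.
  have hmul : ∀ w : EuclideanSpace ℝ (Fin d) → ℂ, (∀ ξ ∈ tsupport g, ContDiffAt ℝ ∞ w ξ) →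
      ContDiff ℝ ∞ (fun ξ => g ξ * w ξ) := fun w hw =>
    (contMDiff_of_tsupport (I := modelWithCornersSelf ℝ (EuclideanSpace ℝ (Fin d))) fun ξ hξ =>
      (hg.contDiffAt.mul (hw ξ (tsupport_mul_subset_left hξ))).contMDiffAt).contDiff
  let h : {s : ℝ // 0 < s} → SchwartzMap (EuclideanSpace ℝ (Fin d)) ℂ := fun s =>
    (hgc.mul_right (f' := fun ξ => 𝓕 ψ (s.1 • ξ) * (G ξ)⁻¹)).toSchwartzMap
      (hmul _ fun ξ hξ => (hΨs s ξ hξ).mul ((hGs ξ hξ).inv (hGne ξ hξ)))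
  let u : {s : ℝ // 0 < s} → SchwartzMap (EuclideanSpace ℝ (Fin d)) ℂ := fun s =>
    (hgc.mul_right (f' := fun ξ => 𝓕 ψ (s.1 • ξ) * (G ξ)⁻¹ * conj (𝓕 ψ (s.1 • ξ)))).toSchwartzMap
      (hmul _ fun ξ hξ => ((hΨs s ξ hξ).mul ((hGs ξ hξ).inv (hGne ξ hξ))).mul (hconj s ξ hξ))
  have hu : ∀ s, (u s : EuclideanSpace ℝ (Fin d) → ℂ) =
      fun ξ => h s ξ * conj (𝓕 ψ (s.1 • ξ)) := by
    intro s
    ext ξ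
    simp [u, h, mul_assoc]
  have hsum : g = ((∑ s ∈ t, u s : SchwartzMap (EuclideanSpace ℝ (Fin d)) ℂ) :
      EuclideanSpace ℝ (Fin d) → ℂ) := by
    ext ξ
    rw [sum_apply]
    by_cases hξ : ξ ∈ tsupport g
    · have : ∀ s, u s ξ = g ξ * (G ξ)⁻¹ * (𝓕 ψ (s.1 • ξ) * conj (𝓕 ψ (s.1 • ξ))) := by
        intro s
        simp only [u, HasCompactSupport.toSchwartzMap_toFun, Pi.mul_apply]
        ring
      simp_rw [this, ← Finset.mul_sum]
      rw [mul_assoc, inv_mul_cancel₀ (hGne ξ hξ), mul_one]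
    · simp [u, image_eq_zero_of_notMem_tsupport hξ]
  have hF : ∀ x, 𝓕 g x = ∑ s ∈ t, 𝓕 (u s) x := by
    intro x
    have := congrArg (fun v : SchwartzMap (EuclideanSpace ℝ (Fin d)) ℂ => v x)
      (map_sum (SchwartzMap.fourierTransformCLM ℂ) u t)
    simp only [sum_apply, SchwartzMap.fourierTransformCLM_apply] at this
    rw [← this, SchwartzMap.fourier_coe, ← hsum]
  simp_rw [hF, Finset.mul_sum]
  rw [integral_finsetSum]
  · refine Finset.sum_eq_zero fun s _ => ?_
    rw [SchwartzMap.fourier_coe, hu]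
    exact integral_mul_fourier_mul_conj_eq_zero hfm hf hψ hψk s.2 (hW s.1 s.2) (h s)
  · intro s _
    exact integrable_mul_of_growth hfm hf (𝓕 (u s)).continuous.aestronglyMeasurable
      ((𝓕 (u s)).integrable_weighted k)

end Wavelet

lemma contDiff_fourierChar_inner {E : Type*} [NormedAddCommGroup E] [InnerProductSpace ℝ E]
    (x : E) :
    ContDiff ℝ ∞ fun ξ : E => (Real.fourierChar (inner ℝ ξ x) : ℂ) := by
  simp_rw [Real.fourierChar_apply]
  have : ContDiff ℝ ∞ fun ξ : E => inner ℝ ξ x := contDiff_id.inner ℝ contDiff_const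
  have h2 : ContDiff ℝ ∞ fun ξ : E => ((2 * Real.pi * inner ℝ ξ x : ℝ) : ℂ) :=
    Complex.ofRealCLM.contDiff.comp (contDiff_const.mul this)
  exact (h2.mul contDiff_const).cexp

lemma HasCompactSupport.comp_const_smul {E : Type*} [NormedAddCommGroup E] [NormedSpace ℝ E] {χ : E → ℂ} (h : HasCompactSupport χ) {R : ℝ}
    (hR : R ≠ 0) : HasCompactSupport fun ξ => χ (R • ξ) :=
  h.comp_homeomorph (Homeomorph.smulOfNeZero R hR)

/-! ### Mollification by a kernel with transform `1` near the origin. -/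

section Mollification

variable {E : Type*} [NormedAddCommGroup E] [InnerProductSpace ℝ E] [FiniteDimensional ℝ E]
  [MeasurableSpace E] [BorelSpace E]

lemma fourier_modulate_dilate (χ : E → ℂ) {R : ℝ} (hR : 0 < R) (x y : E) :
    𝓕 (fun ξ => (Real.fourierChar (inner ℝ ξ x) : ℂ) * χ (R • ξ)) y =
      ((R ^ Module.finrank ℝ E)⁻¹ : ℝ) • 𝓕⁻ χ (R⁻¹ • (x - y)) := by
  have h := Measure.integral_comp_smul (volume : Measure E)
    (fun η => Real.fourierChar (inner ℝ η (R⁻¹ • (x - y))) • χ η) R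
  rw [abs_of_pos (by positivity)] at h
  rw [Real.fourierInv_eq, ← h, Real.fourier_eq]
  congr 1 with ξ
  rw [Circle.smul_def, Circle.smul_def, smul_eq_mul, smul_eq_mul, ← mul_assoc, ← Circle.coe_mul,
    ← AddChar.map_add_eq_mul, inner_smul_left, inner_smul_right, inner_sub_right]
  congr 4
  simp only [conj_trivial]
  field_simp
  ring

lemma integral_comp_sub_smul_mul (f φ : E → ℂ) {R : ℝ} (hR : 0 < R) (x : E) :
    ∫ y, f (x + (-R) • y) * φ y =
      ∫ z, f z * (((R ^ Module.finrank ℝ E)⁻¹ : ℝ) • φ (R⁻¹ • (x - z))) := by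
  have h := Measure.integral_comp_smul (volume : Measure E)
    (fun w => f (x - w) * φ (R⁻¹ • w)) R
  have h2 := integral_sub_left_eq_self (fun z => f z * φ (R⁻¹ • (x - z))) volume x
  simp only [sub_sub_cancel] at h2
  rw [h2, abs_of_pos (by positivity), ← integral_smul] at h
  simp only [smul_smul, inv_mul_cancel₀ hR.ne', one_smul] at h
  simp_rw [mul_smul_comm]
  simpa [sub_eq_add_neg] using h

/-- Writes the mollification as a pairing of `f` with the transform of a modulated dilate of `χ`,
the form to which the support hypothesis on the Fourier side applies. -/
lemma integral_comp_sub_smul_mul_fourierInv (f χ : E → ℂ) {R : ℝ} (hR : 0 < R) (x : E) :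
    ∫ y, f (x + (-R) • y) * 𝓕⁻ χ y =
      ∫ z, f z * 𝓕 (fun ξ => (Real.fourierChar (inner ℝ ξ x) : ℂ) * χ (R • ξ)) z := by
  simp_rw [integral_comp_sub_smul_mul f _ hR x, fourier_modulate_dilate χ hR]

/-- If `∫ f 𝓕g = 0` for all test functions `g` supported away from the origin, the mollifications
of `f` by a kernel whose Fourier transform is `1` near the origin do not depend on the scale. -/
lemma integral_mollify_eq {f : E → ℂ} {C : ℝ} {k : ℕ} (hfm : AEStronglyMeasurable f volume)
    (hf : ∀ᵐ x, ‖f x‖ ≤ C * (1 + ‖x‖) ^ k)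
    (hT : ∀ g : E → ℂ, ContDiff ℝ ∞ g → HasCompactSupport g → (0 : E) ∉ tsupport g →
      ∫ x, f x * 𝓕 g x = 0)
    {χ : E → ℂ} (hχ : ContDiff ℝ ∞ χ) (hχc : HasCompactSupport χ)
    (hχ1 : ∀ᶠ ξ in nhds 0, χ ξ = 1) {R S : ℝ} (hR : 0 < R) (hS : 0 < S) (x : E) :
    ∫ y, f (x + (-R) • y) * 𝓕⁻ χ y = ∫ y, f (x + (-S) • y) * 𝓕⁻ χ y := by
  rw [integral_comp_sub_smul_mul_fourierInv f χ hR, integral_comp_sub_smul_mul_fourierInv f χ hS,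
    ← sub_eq_zero]
  have hg : ∀ r : ℝ, ContDiff ℝ ∞
      fun ξ => (Real.fourierChar (inner ℝ ξ x) : ℂ) * χ (r • ξ) := fun r =>
    (contDiff_fourierChar_inner x).mul (hχ.comp (contDiff_const_smul r))
  have hgc : ∀ r : ℝ, r ≠ 0 → HasCompactSupport
      fun ξ => (Real.fourierChar (inner ℝ ξ x) : ℂ) * χ (r • ξ) := fun r hr =>
    (hχc.comp_const_smul hr).mul_left
  set u : SchwartzMap E ℂ := (hgc R hR.ne').toSchwartzMap (hg R) with hu
  set v : SchwartzMap E ℂ := (hgc S hS.ne').toSchwartzMap (hg S) with hv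
  have hint : ∀ w : SchwartzMap E ℂ, Integrable fun x => f x * 𝓕 w x := fun w =>
    integrable_mul_of_growth hfm hf (𝓕 w).continuous.aestronglyMeasurable
      ((𝓕 w).integrable_weighted k)
  have hnear : ∀ r : ℝ, ∀ᶠ ξ : E in nhds 0, χ (r • ξ) = 1 := fun r =>
    (by fun_prop : Continuous fun ξ : E => r • ξ).tendsto' 0 0 (smul_zero r) |>.eventually hχ1
  -- Both cutoffs are `1` near `0`, so the two modulated functions cancel there and their difference
  -- is an admissible test function.
  have h0 := hT (fun ξ => u ξ - v ξ) (u.smooth ⊤ |>.sub (v.smooth ⊤))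
    ((hgc R hR.ne').sub (hgc S hS.ne')) (by
      rw [notMem_tsupport_iff_eventuallyEq]
      filter_upwards [hnear R, hnear S] with ξ h1 h2
      simp [hu, hv, h1, h2])
  have h1 : ∀ z, 𝓕 (fun ξ => u ξ - v ξ) z = 𝓕 u z - 𝓕 v z := by
    intro z
    have := congrArg (fun w : SchwartzMap E ℂ => w z)
      (map_sub (SchwartzMap.fourierTransformCLM ℂ) u v)
    simp only [SchwartzMap.fourierTransformCLM_apply, sub_apply] at this
    exact this
  simp_rw [h1, mul_sub] at h0
  rw [integral_sub (hint u) (hint v)] at h0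
  exact h0

/-- Dominated convergence on `E × E`. Placing the mollifier on the Schwartz function `h` avoids any
regularity of `f`. -/
lemma tendsto_integral_mollify {f : E → ℂ} {C : ℝ} {k : ℕ} (hfm : AEStronglyMeasurable f volume)
    (hf : ∀ᵐ x, ‖f x‖ ≤ C * (1 + ‖x‖) ^ k) (h φ : SchwartzMap E ℂ) :
    Filter.Tendsto (fun R : ℝ => ∫ x, f x * ∫ y, h (x - (-R) • y) * φ y)
      (nhdsWithin 0 (Set.Ioi 0)) (nhds ((∫ x, f x * h x) * ∫ y, φ y)) := by
  have hi : ∀ R : ℝ, Integrable (fun p : E × E => f p.1 * (h (p.1 - (-R) • p.2) * φ p.2))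
      (volume.prod volume) := fun R =>
    integrable_shear' hfm hf h.continuous.aestronglyMeasurable φ.continuous.aestronglyMeasurable
      (h.integrable_weighted k) (φ.integrable_weighted k) (-R)
  have h1 : ∀ R : ℝ, ∫ x, f x * ∫ y, h (x - (-R) • y) * φ y =
      ∫ p : E × E, f p.1 * (h (p.1 - (-R) • p.2) * φ p.2) ∂(volume.prod volume) := by
    intro R
    rw [integral_prod _ (hi R)]
    simp_rw [integral_const_mul]
  have h2 : (∫ x, f x * h x) * ∫ y, φ y =
      ∫ p : E × E, f p.1 * (h p.1 * φ p.2) ∂(volume.prod volume) := by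
    rw [← integral_prod_mul]
    simp_rw [mul_assoc]
  rw [h2]
  simp_rw [h1]
  obtain ⟨N, hN⟩ : ∃ N, N = Module.finrank ℝ E + 1 := ⟨_, rfl⟩
  -- Decay of order `k` absorbs the growth of `f`; the further `N = dim + 1` make the majorant
  -- integrable.
  obtain ⟨D, hD0, hD⟩ := h.exists_weighted_bound (k + N) 0
  have hb := ((integrable_inv_one_add_norm_pow (E := E)).const_mul (|C| * D)).mul_prod
    (φ.integrable_weighted (k + N))
  rw [← hN] at hb
  refine tendsto_integral_filter_of_dominated_convergence _
    (Filter.Eventually.of_forall fun R => (hi R).1) ?_ hb ?_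
  · have hR1 : ∀ᶠ R : ℝ in nhdsWithin 0 (Set.Ioi 0), R ∈ Set.Ioo (0 : ℝ) 1 :=
      Ioo_mem_nhdsGT zero_lt_one
    filter_upwards [hR1] with R hR
    filter_upwards [Measure.quasiMeasurePreserving_fst.ae hf] with p hp
    have hmax : max 1 |R| = 1 := max_eq_left (by rw [abs_of_pos hR.1]; exact hR.2.le)
    have hA : (1 + ‖p.1‖) ^ (k + N) ≤
        (1 + ‖p.1 - (-R) • p.2‖) ^ (k + N) * (1 + ‖p.2‖) ^ (k + N) := by
      rw [← mul_pow]
      refine pow_le_pow_left₀ (by positivity) ?_ _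
      have e1 := one_add_norm_add_le (p.1 - (-R) • p.2) ((-R) • p.2)
      have e2 := one_add_norm_smul_le (-R) p.2
      rw [sub_add_cancel] at e1
      rw [abs_neg, hmax, one_mul] at e2
      exact e1.trans (by gcongr)
    have hB := hD (p.1 - (-R) • p.2)
    rw [norm_iteratedFDeriv_zero] at hB
    have hH : ‖h (p.1 - (-R) • p.2)‖ * (1 + ‖p.1‖) ^ (k + N) ≤ D * (1 + ‖p.2‖) ^ (k + N) := by
      calc _ ≤ ‖h (p.1 - (-R) • p.2)‖ *
            ((1 + ‖p.1 - (-R) • p.2‖) ^ (k + N) * (1 + ‖p.2‖) ^ (k + N)) := by gcongr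
        _ = ((1 + ‖p.1 - (-R) • p.2‖) ^ (k + N) * ‖h (p.1 - (-R) • p.2)‖) *
            (1 + ‖p.2‖) ^ (k + N) := by ring
        _ ≤ _ := by gcongr
    have hF : ‖f p.1‖ ≤ |C| * (1 + ‖p.1‖) ^ k :=
      hp.trans (by gcongr; exact le_abs_self C)
    rw [norm_mul, norm_mul]
    calc ‖f p.1‖ * (‖h (p.1 - (-R) • p.2)‖ * ‖φ p.2‖)
        ≤ (|C| * (1 + ‖p.1‖) ^ k) * (‖h (p.1 - (-R) • p.2)‖ * ‖φ p.2‖) := by gcongr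
      _ = |C| * ((1 + ‖p.1‖) ^ N)⁻¹ *
          (‖h (p.1 - (-R) • p.2)‖ * (1 + ‖p.1‖) ^ (k + N)) * ‖φ p.2‖ := by
          rw [pow_add]
          field_simp
      _ ≤ |C| * ((1 + ‖p.1‖) ^ N)⁻¹ * (D * (1 + ‖p.2‖) ^ (k + N)) * ‖φ p.2‖ := by gcongr
      _ = _ := by ring
  · refine Filter.Eventually.of_forall fun p => ?_
    have hc : Continuous fun R : ℝ => f p.1 * (h (p.1 - (-R) • p.2) * φ p.2) := by fun_prop
    have := hc.tendsto 0
    simp only [neg_zero, zero_smul, sub_zero] at this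
    exact this.mono_left nhdsWithin_le_nhds

end Mollification

/-! ### Polynomial functions of bounded degree. -/

noncomputable section PolynomialFunctions

variable {d : ℕ}

/-- The complex polynomial functions on `ℝᵈ` of total degree at most `k`. -/
def polyFunctionsOfDegreeLE (d k : ℕ) : Submodule ℂ (EuclideanSpace ℝ (Fin d) → ℂ) :=
  (MvPolynomial.restrictTotalDegree (Fin d) ℂ k).map
    (MvPolynomial.aeval (fun i (x : EuclideanSpace ℝ (Fin d)) => (x i : ℂ))).toLinearMap

lemma aeval_coordinates_apply (p : MvPolynomial (Fin d) ℂ) (x : EuclideanSpace ℝ (Fin d)) :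
    MvPolynomial.aeval (fun i (x : EuclideanSpace ℝ (Fin d)) => (x i : ℂ)) p x =
      MvPolynomial.eval (fun i => (x i : ℂ)) p := by
  induction p using MvPolynomial.induction_on with
  | C a => simp
  | add p q hp hq => simp [hp, hq]
  | mul_X p i hp => simp [hp]

lemma mem_polyFunctionsOfDegreeLE {k : ℕ} {F : EuclideanSpace ℝ (Fin d) → ℂ} :
    F ∈ polyFunctionsOfDegreeLE d k ↔ ∃ p : MvPolynomial (Fin d) ℂ, p.totalDegree ≤ k ∧
      F = fun x => MvPolynomial.eval (fun i => (x i : ℂ)) p := by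
  simp only [polyFunctionsOfDegreeLE, Submodule.mem_map, MvPolynomial.mem_restrictTotalDegree,
    AlgHom.toLinearMap_apply]
  refine exists_congr fun p => and_congr_right fun _ => ?_
  rw [eq_comm]
  simp only [funext_iff, aeval_coordinates_apply]

/-- A finite-dimensional subspace is closed; the topology here is that of pointwise convergence. -/
lemma isClosed_polyFunctionsOfDegreeLE (d k : ℕ) :
    IsClosed (polyFunctionsOfDegreeLE d k : Set (EuclideanSpace ℝ (Fin d) → ℂ)) := by
  have : FiniteDimensional ℂ (polyFunctionsOfDegreeLE d k) := by
    unfold polyFunctionsOfDegreeLE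
    infer_instance
  exact Submodule.closed_of_finiteDimensional _

lemma continuous_of_mem_polyFunctionsOfDegreeLE {k : ℕ} {F : EuclideanSpace ℝ (Fin d) → ℂ}
    (hF : F ∈ polyFunctionsOfDegreeLE d k) : Continuous F := by
  obtain ⟨p, -, rfl⟩ := mem_polyFunctionsOfDegreeLE.1 hF
  have := p.continuous_eval
  fun_prop

lemma prod_coordinates_mem_polyFunctionsOfDegreeLE {j k : ℕ} (hjk : j ≤ k) (r : Fin j → Fin d) :
    (fun x : EuclideanSpace ℝ (Fin d) => ∏ l, (x (r l) : ℂ)) ∈ polyFunctionsOfDegreeLE d k := by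
  refine mem_polyFunctionsOfDegreeLE.2 ⟨∏ l, MvPolynomial.X (r l), ?_, ?_⟩
  · refine (MvPolynomial.totalDegree_finsetProd _ _).trans ?_
    simpa using hjk
  · ext x
    simp

lemma ContinuousMultilinearMap.diagonal_mem_polyFunctionsOfDegreeLE {j k : ℕ} (hjk : j ≤ k)
    (M : ContinuousMultilinearMap ℝ (fun _ : Fin j => EuclideanSpace ℝ (Fin d)) ℂ) :
    (fun x => M fun _ => x) ∈ polyFunctionsOfDegreeLE d k := by
  have h : (fun x => M fun _ => x) = ∑ r : Fin j → Fin d,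
      M (fun l => EuclideanSpace.single (r l) 1) •
        fun x : EuclideanSpace ℝ (Fin d) => ∏ l, (x (r l) : ℂ) := by
    ext x
    have hx : x = ∑ i, x i • EuclideanSpace.single i (1 : ℝ) := by
      have := (EuclideanSpace.basisFun (Fin d) ℝ).sum_repr x
      simpa using this.symm
    conv_lhs => rw [hx]
    rw [M.map_sum]
    simp only [Finset.sum_apply, Pi.smul_apply, smul_eq_mul]
    refine Finset.sum_congr rfl fun r _ => ?_
    rw [M.map_smul_univ]
    simp [mul_comm]
  rw [h]
  exact Submodule.sum_mem _ fun r _ =>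
    Submodule.smul_mem _ _ (prod_coordinates_mem_polyFunctionsOfDegreeLE hjk r)

end PolynomialFunctions

/-! ### Taylor expansion with weighted remainder. -/

noncomputable section Taylor

variable {E : Type*} [NormedAddCommGroup E] [InnerProductSpace ℝ E]

/-- The Taylor polynomial of degree `k` of `φ` at `v`, evaluated at the increment `w`. -/
def taylorPolynomial (φ : E → ℂ) (k : ℕ) (v w : E) : ℂ :=
  ∑ j ∈ Finset.range (k + 1), (j.factorial : ℝ)⁻¹ • iteratedFDeriv ℝ j φ v fun _ => w

lemma SchwartzMap.exists_taylor_bound (φ : SchwartzMap E ℂ) (n k : ℕ) :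
    ∃ D, 0 ≤ D ∧ ∀ v w : E, ‖w‖ ≤ 1 →
      (1 + ‖v‖) ^ n * ‖φ (v + w) - taylorPolynomial φ k v w‖ ≤ D * ‖w‖ ^ (k + 1) := by
  obtain ⟨D, hD0, hD⟩ := φ.exists_weighted_bound n (k + 1)
  -- For `‖w‖ ≤ 1` the weights at `v` and `v + t • w` differ by a factor of at most `2`, whence `2 ^
  -- n`.
  refine ⟨2 ^ n * D, by positivity, fun v w hw => ?_⟩
  have h := map_add_eq_sum_add_integral_iteratedFDeriv (f := φ) (x := v) (y := w) (n := k)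
    (fun t _ => by exact_mod_cast φ.contDiffAt (k + 1 : ℕ))
  rw [h, taylorPolynomial, add_sub_cancel_left, norm_smul]
  have hint : ‖∫ t in (0:ℝ)..1, (1 - t) ^ k •
      iteratedFDeriv ℝ (k + 1) φ (v + t • w) fun _ => w‖ ≤
      (2 ^ n * D * ((1 + ‖v‖) ^ n)⁻¹ * ‖w‖ ^ (k + 1)) * |(1:ℝ) - 0| := by
    refine intervalIntegral.norm_integral_le_of_norm_le_const fun t ht => ?_
    rw [Set.uIoc_of_le zero_le_one] at ht
    have h1 : ‖(1 - t) ^ k‖ ≤ 1 := by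
      rw [norm_pow, Real.norm_eq_abs]
      exact pow_le_one₀ (abs_nonneg _) (by rw [abs_le]; constructor <;> linarith [ht.1, ht.2])
    have h2 : ‖iteratedFDeriv ℝ (k + 1) φ (v + t • w) fun _ => w‖ ≤
        ‖iteratedFDeriv ℝ (k + 1) φ (v + t • w)‖ * ‖w‖ ^ (k + 1) := by
      simpa using (iteratedFDeriv ℝ (k + 1) φ (v + t • w)).le_opNorm fun _ => w
    have h3 : 1 + ‖v‖ ≤ (1 + ‖v + t • w‖) * 2 := by
      have := one_add_norm_add_le (v + t • w) (-(t • w))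
      rw [add_neg_cancel_right, norm_neg, norm_smul, Real.norm_of_nonneg ht.1.le] at this
      refine this.trans ?_
      gcongr
      nlinarith [ht.1, ht.2, norm_nonneg w]
    have h4 : (1 + ‖v‖) ^ n * ‖iteratedFDeriv ℝ (k + 1) φ (v + t • w)‖ ≤ 2 ^ n * D := by
      calc _ ≤ ((1 + ‖v + t • w‖) * 2) ^ n * ‖iteratedFDeriv ℝ (k + 1) φ (v + t • w)‖ := by
            gcongr
        _ = 2 ^ n * ((1 + ‖v + t • w‖) ^ n * ‖iteratedFDeriv ℝ (k + 1) φ (v + t • w)‖) := by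
            rw [mul_pow]; ring
        _ ≤ _ := by gcongr; exact hD _
    have h5 : ‖iteratedFDeriv ℝ (k + 1) φ (v + t • w)‖ ≤ 2 ^ n * D * ((1 + ‖v‖) ^ n)⁻¹ := by
      rw [← div_eq_mul_inv, le_div_iff₀ (by positivity)]
      linarith
    rw [norm_smul]
    calc _ ≤ 1 * (‖iteratedFDeriv ℝ (k + 1) φ (v + t • w)‖ * ‖w‖ ^ (k + 1)) := by gcongr
      _ ≤ _ := by rw [one_mul]; gcongr
  rw [sub_zero, abs_one, mul_one] at hint
  have hk : ‖((k.factorial : ℝ)⁻¹)‖ ≤ 1 := by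
    rw [Real.norm_of_nonneg (by positivity)]
    exact inv_le_one_of_one_le₀ (by exact_mod_cast Nat.factorial_pos k)
  calc _ ≤ (1 + ‖v‖) ^ n * (1 * (2 ^ n * D * ((1 + ‖v‖) ^ n)⁻¹ * ‖w‖ ^ (k + 1))) := by gcongr
    _ = _ := by field_simp

end Taylor

/-! ### The limits of large and small scale. -/

section PolynomialLimit

lemma ae_norm_comp_neg_smul_le {E : Type*} [NormedAddCommGroup E] [InnerProductSpace ℝ E]
    [FiniteDimensional ℝ E] [MeasurableSpace E] [BorelSpace E] {f : E → ℂ} {C : ℝ} {k : ℕ}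
    (hf : ∀ᵐ x, ‖f x‖ ≤ C * (1 + ‖x‖) ^ k) {R : ℝ} (hR : 1 ≤ R) :
    ∀ᵐ v, ‖f ((-R) • v)‖ ≤ (|C| * R ^ k) * (1 + ‖v‖) ^ k := by
  have hR0 : -R ≠ 0 := by linarith
  filter_upwards [(Measure.quasiMeasurePreserving_smul volume hR0).ae hf] with v hv
  have h := one_add_norm_smul_le (-R) v
  rw [abs_neg, abs_of_pos (by linarith), max_eq_right hR] at h
  calc _ ≤ C * (1 + ‖(-R) • v‖) ^ k := hv
    _ ≤ |C| * (R * (1 + ‖v‖)) ^ k := by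
        gcongr
        exact le_abs_self C
    _ = _ := by rw [mul_pow]; ring

variable {d : ℕ} {f : EuclideanSpace ℝ (Fin d) → ℂ} {C : ℝ} {k : ℕ}

lemma integrable_mul_taylorPolynomial_term (hfm : AEStronglyMeasurable f volume)
    (hf : ∀ᵐ x, ‖f x‖ ≤ C * (1 + ‖x‖) ^ k) (φ : SchwartzMap (EuclideanSpace ℝ (Fin d)) ℂ) (j : ℕ) :
    Integrable fun v => f v • iteratedFDeriv ℝ j φ v := by
  have hc : Continuous (iteratedFDeriv ℝ j φ) := (φ.smooth j).continuous_iteratedFDeriv le_rfl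
  refine ((φ.integrable_weighted_iteratedFDeriv k j).const_mul C).mono'
    (hfm.smul hc.aestronglyMeasurable) ?_
  filter_upwards [hf] with x hx
  rw [norm_smul, ← mul_assoc]
  gcongr

lemma integrable_mul_taylorPolynomial_term_apply (hfm : AEStronglyMeasurable f volume)
    (hf : ∀ᵐ x, ‖f x‖ ≤ C * (1 + ‖x‖) ^ k) (φ : SchwartzMap (EuclideanSpace ℝ (Fin d)) ℂ) (j : ℕ)
    (w : EuclideanSpace ℝ (Fin d)) :
    Integrable fun v => ((j.factorial : ℝ)⁻¹) • (f v * iteratedFDeriv ℝ j φ v fun _ => w) := by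
  have h : Integrable fun v => f v * iteratedFDeriv ℝ j φ v fun _ => w :=
    (ContinuousMultilinearMap.apply ℝ (fun _ : Fin j => EuclideanSpace ℝ (Fin d)) ℂ
      (fun _ => w)).integrable_comp (integrable_mul_taylorPolynomial_term hfm hf φ j)
  exact h.smul ((j.factorial : ℝ)⁻¹)

lemma integrable_mul_taylorPolynomial (hfm : AEStronglyMeasurable f volume)
    (hf : ∀ᵐ x, ‖f x‖ ≤ C * (1 + ‖x‖) ^ k) (φ : SchwartzMap (EuclideanSpace ℝ (Fin d)) ℂ)
    (n : ℕ) (w : EuclideanSpace ℝ (Fin d)) :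
    Integrable fun v => f v * taylorPolynomial φ n v w := by
  simp_rw [taylorPolynomial, Finset.mul_sum]
  refine integrable_finsetSum _ fun j _ => ?_
  simp_rw [mul_smul_comm]
  exact integrable_mul_taylorPolynomial_term_apply hfm hf φ j w

/-- Integrating the `j`-th derivative against `f` gives one fixed multilinear form; its diagonal is
a homogeneous polynomial of degree `j`, and `r` contributes `r ^ j`. -/
lemma integral_mul_taylorPolynomial_mem (hfm : AEStronglyMeasurable f volume)
    (hf : ∀ᵐ x, ‖f x‖ ≤ C * (1 + ‖x‖) ^ k) (φ : SchwartzMap (EuclideanSpace ℝ (Fin d)) ℂ)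
    (n : ℕ) (r : ℝ) :
    (fun x => ∫ v, f v * taylorPolynomial φ n v (r • x)) ∈ polyFunctionsOfDegreeLE d n := by
  have h : (fun x => ∫ v, f v * taylorPolynomial φ n v (r • x)) =
      ∑ j ∈ Finset.range (n + 1), (((j.factorial : ℝ)⁻¹ * r ^ j : ℝ) : ℂ) •
        fun x => (∫ v, f v • iteratedFDeriv ℝ j φ v) fun _ => x := by
    ext x
    simp_rw [taylorPolynomial, Finset.mul_sum, mul_smul_comm]
    have hi := integrable_mul_taylorPolynomial_term hfm hf φ
    rw [integral_finsetSum]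
    · rw [Finset.sum_apply]
      refine Finset.sum_congr rfl fun j _ => ?_
      have := ((∫ v, f v • iteratedFDeriv ℝ j φ v)).map_smul_univ (fun _ => r) (fun _ => x)
      rw [ContinuousMultilinearMap.integral_apply (hi j)] at this
      simp only [smul_apply, smul_eq_mul, Finset.prod_const,
        Finset.card_univ, Fintype.card_fin] at this
      rw [integral_smul, this, Pi.smul_apply]
      simp only [Complex.real_smul, smul_eq_mul, Complex.ofReal_mul]
      ring
    · intro j _
      exact integrable_mul_taylorPolynomial_term_apply hfm hf φ j _
  rw [h]
  exact Submodule.sum_mem _ fun j hj => Submodule.smul_mem _ _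
    (ContinuousMultilinearMap.diagonal_mem_polyFunctionsOfDegreeLE
      (Nat.lt_succ_iff.1 (Finset.mem_range.1 hj)) _)

lemma integral_mollify_eq_integral_translate (f φ : EuclideanSpace ℝ (Fin d) → ℂ) {R : ℝ}
    (hR : 0 < R) (x : EuclideanSpace ℝ (Fin d)) :
    ∫ y, f (x + (-R) • y) * φ y = ∫ v, f ((-R) • v) * φ (v + R⁻¹ • x) := by
  rw [← integral_add_right_eq_self _ (R⁻¹ • x)]
  congr 1 with v
  rw [smul_add, smul_smul, neg_mul, mul_inv_cancel₀ hR.ne', neg_one_smul]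
  congr 2
  abel

/-- Dilating `f` costs `R ^ k`, while the Taylor remainder at increment `R⁻¹ • x` gains `R⁻¹ ^ (k +
1)`; one factor `R⁻¹` survives. -/
lemma norm_mollify_sub_le (hfm : AEStronglyMeasurable f volume)
    (hf : ∀ᵐ x, ‖f x‖ ≤ C * (1 + ‖x‖) ^ k) (φ : SchwartzMap (EuclideanSpace ℝ (Fin d)) ℂ)
    (x : EuclideanSpace ℝ (Fin d)) :
    ∃ K, ∀ R : ℝ, max 1 ‖x‖ ≤ R →
      ‖(∫ y, f (x + (-R) • y) * φ y) -
        ∫ v, f ((-R) • v) * taylorPolynomial φ k v (R⁻¹ • x)‖ ≤ K * R⁻¹ := by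
  set N := d + 1 with hN
  obtain ⟨D, hD0, hD⟩ := φ.exists_taylor_bound (k + N) k
  have hJ := integrable_inv_one_add_norm_pow (E := EuclideanSpace ℝ (Fin d))
  rw [finrank_euclideanSpace_fin, ← hN] at hJ
  refine ⟨|C| * D * ‖x‖ ^ (k + 1) *
    ∫ v : EuclideanSpace ℝ (Fin d), ((1 + ‖v‖) ^ N)⁻¹, fun R hR => ?_⟩
  have hR1 : 1 ≤ R := (le_max_left _ _).trans hR
  have hR0 : 0 < R := by linarith
  have hg := ae_norm_comp_neg_smul_le hf hR1
  have hgm : AEStronglyMeasurable (fun v => f ((-R) • v)) volume :=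
    hfm.comp_quasiMeasurePreserving
      (Measure.quasiMeasurePreserving_smul volume (neg_ne_zero.2 hR0.ne'))
  have hw : ‖R⁻¹ • x‖ = R⁻¹ * ‖x‖ := by
    rw [norm_smul, Real.norm_of_nonneg (by positivity)]
  have hw1 : ‖R⁻¹ • x‖ ≤ 1 := by
    rw [hw, inv_mul_le_iff₀ hR0, mul_one]
    exact (le_max_right _ _).trans hR
  have hi : Integrable fun v => f ((-R) • v) * φ (v + R⁻¹ • x) := by
    refine integrable_mul_of_growth hgm hg (by fun_prop) ?_
    have := SchwartzMap.integrable_weighted (SchwartzMap.compSubConstCLM ℂ (-(R⁻¹ • x)) φ) k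
    simpa [SchwartzMap.compSubConstCLM_apply] using this
  rw [integral_mollify_eq_integral_translate f φ hR0,
    ← integral_sub hi (integrable_mul_taylorPolynomial hgm hg φ k _)]
  have hbound : ∀ᵐ v, ‖f ((-R) • v) * φ (v + R⁻¹ • x) -
      f ((-R) • v) * taylorPolynomial φ k v (R⁻¹ • x)‖ ≤
      (|C| * D * ‖x‖ ^ (k + 1) * R⁻¹) * ((1 + ‖v‖) ^ N)⁻¹ := by
    filter_upwards [hg] with v hv
    have h1 : ‖φ (v + R⁻¹ • x) - taylorPolynomial φ k v (R⁻¹ • x)‖ ≤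
        D * ‖R⁻¹ • x‖ ^ (k + 1) * ((1 + ‖v‖) ^ (k + N))⁻¹ := by
      rw [← div_eq_mul_inv, le_div_iff₀ (by positivity), mul_comm]
      exact hD v _ hw1
    rw [← mul_sub, norm_mul]
    calc _ ≤ (|C| * R ^ k * (1 + ‖v‖) ^ k) *
          (D * ‖R⁻¹ • x‖ ^ (k + 1) * ((1 + ‖v‖) ^ (k + N))⁻¹) := by gcongr
      _ = _ := by
          rw [hw, mul_pow, pow_add (1 + ‖v‖), pow_succ R⁻¹, inv_pow]
          clear_value N
          field_simp
  refine (norm_integral_le_of_norm_le (hJ.const_mul _) hbound).trans (le_of_eq ?_)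
  rw [integral_const_mul]
  ring

lemma mollification_mem_polyFunctions (hfm : AEStronglyMeasurable f volume)
    (hf : ∀ᵐ x, ‖f x‖ ≤ C * (1 + ‖x‖) ^ k) (φ : SchwartzMap (EuclideanSpace ℝ (Fin d)) ℂ)
    {F : EuclideanSpace ℝ (Fin d) → ℂ}
    (hF : ∀ R : ℝ, 0 < R → ∀ x, ∫ y, f (x + (-R) • y) * φ y = F x) :
    F ∈ polyFunctionsOfDegreeLE d k := by
  refine (isClosed_polyFunctionsOfDegreeLE d k).mem_of_tendsto (b := Filter.atTop)
    (f := fun (R : ℝ) x => ∫ v, f ((-R) • v) * taylorPolynomial φ k v (R⁻¹ • x)) ?_ ?_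
  · refine tendsto_pi_nhds.2 fun x => ?_
    obtain ⟨K, hK⟩ := norm_mollify_sub_le hfm hf φ x
    rw [← tendsto_sub_nhds_zero_iff]
    refine squeeze_zero_norm' (a := fun R => K * R⁻¹) ?_
      (by simpa using tendsto_inv_atTop_zero.const_mul K)
    filter_upwards [Filter.eventually_ge_atTop (max 1 ‖x‖)] with R hR
    have hR0 : 0 < R := by linarith [le_max_left 1 ‖x‖]
    rw [norm_sub_rev, ← hF R hR0 x]
    exact hK R hR
  · filter_upwards [Filter.eventually_ge_atTop (1 : ℝ)] with R hR
    exact integral_mul_taylorPolynomial_mem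
      (hfm.comp_quasiMeasurePreserving (Measure.quasiMeasurePreserving_smul volume
        (by linarith : -R ≠ 0)))
      (ae_norm_comp_neg_smul_le hf hR) φ k R⁻¹

/-- Tested against a smooth compactly supported `h`, the mollified pairing is constant in `R`, while
its limit as `R → 0` is `∫ f h`. -/
lemma ae_eq_mollification (hfl : LocallyIntegrable f volume)
    (hf : ∀ᵐ x, ‖f x‖ ≤ C * (1 + ‖x‖) ^ k) (φ : SchwartzMap (EuclideanSpace ℝ (Fin d)) ℂ)
    (hφ : ∫ y, φ y = 1) {F : EuclideanSpace ℝ (Fin d) → ℂ} (hFc : Continuous F)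
    (hF : ∀ R : ℝ, 0 < R → ∀ x, ∫ y, f (x + (-R) • y) * φ y = F x) : f =ᵐ[volume] F := by
  have hfm := hfl.aestronglyMeasurable
  refine ae_eq_of_integral_contDiff_smul_eq hfl hFc.locallyIntegrable fun g hg hgc => ?_
  let h : SchwartzMap (EuclideanSpace ℝ (Fin d)) ℂ :=
    (hgc.comp_left (g := Complex.ofReal) Complex.ofReal_zero).toSchwartzMap
      (Complex.ofRealCLM.contDiff.comp hg)
  have hh : ∀ x, h x = (g x : ℂ) := fun x => rfl
  have hlim := tendsto_integral_mollify hfm hf h φ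
  have hconst : ∀ᶠ R : ℝ in nhdsWithin 0 (Set.Ioi 0),
      ∫ x, h x * F x = ∫ x, f x * ∫ y, h (x - (-R) • y) * φ y := by
    filter_upwards [self_mem_nhdsWithin] with R hR
    rw [integral_shear hfm hf h.continuous.aestronglyMeasurable φ.continuous.aestronglyMeasurable
      (h.integrable_weighted k) (φ.integrable_weighted k)]
    simp_rw [hF R hR]
  have := tendsto_nhds_unique hlim (tendsto_const_nhds.congr' hconst)
  rw [hφ, mul_one] at this
  simp_rw [hh] at this
  simp_rw [Complex.real_smul, ← this, mul_comm]

end PolynomialLimit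

/-- A function of polynomial growth whose Fourier transform is supported at the origin is a
polynomial. -/
lemma ae_eq_polynomial_of_fourier_supported_at_zero {d : ℕ} {f : EuclideanSpace ℝ (Fin d) → ℂ}
    {C : ℝ} {k : ℕ} (hfl : LocallyIntegrable f volume) (hf : ∀ᵐ x, ‖f x‖ ≤ C * (1 + ‖x‖) ^ k)
    (hT : ∀ g : EuclideanSpace ℝ (Fin d) → ℂ, ContDiff ℝ ∞ g → HasCompactSupport g →
      (0 : EuclideanSpace ℝ (Fin d)) ∉ tsupport g → ∫ x, f x * 𝓕 g x = 0) :
    ∃ F ∈ polyFunctionsOfDegreeLE d k, f =ᵐ[volume] F := by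
  let b : ContDiffBump (0 : EuclideanSpace ℝ (Fin d)) := ⟨1, 2, one_pos, one_lt_two⟩
  have hχ : ContDiff ℝ ∞ fun ξ => (b ξ : ℂ) := Complex.ofRealCLM.contDiff.comp b.contDiff
  have hχc : HasCompactSupport fun ξ => (b ξ : ℂ) :=
    b.hasCompactSupport.comp_left Complex.ofReal_zero
  have hχ1 : ∀ᶠ ξ in nhds 0, (b ξ : ℂ) = 1 := by
    filter_upwards [b.eventuallyEq_one] with ξ hξ
    simp [hξ]
  let χ := hχc.toSchwartzMap hχ
  let φ := 𝓕⁻ χ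
  -- The integral of `φ` is `𝓕 φ` at `0`, that is `χ 0`.
  have hφ : ∫ y, φ y = 1 := by
    have h1 : 𝓕 φ = χ := FourierTransform.fourier_fourierInv_eq χ
    have h2 := congrArg (fun w : SchwartzMap (EuclideanSpace ℝ (Fin d)) ℂ => w 0) h1
    simp only [SchwartzMap.fourier_coe, Real.fourier_eq, inner_zero_right, neg_zero,
      AddChar.map_zero_eq_one, one_smul] at h2
    rw [h2]
    exact hχ1.self_of_nhds
  have hF : ∀ R : ℝ, 0 < R → ∀ x, ∫ y, f (x + (-R) • y) * φ y =
      ∫ y, f (x + (-1 : ℝ) • y) * φ y := fun R hR x => by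
    have := integral_mollify_eq hfl.aestronglyMeasurable hf hT hχ hχc hχ1 hR one_pos x
    have hφc : (φ : EuclideanSpace ℝ (Fin d) → ℂ) = 𝓕⁻ fun ξ => (b ξ : ℂ) :=
      SchwartzMap.fourierInv_coe χ
    rw [hφc]
    exact this
  have hmem := mollification_mem_polyFunctions hfl.aestronglyMeasurable hf φ hF
  exact ⟨_, hmem, ae_eq_mollification hfl hf φ hφ
    (continuous_of_mem_polyFunctionsOfDegreeLE hmem) hF⟩

lemma ae_norm_le_of_memLp_top {d k : ℕ} {f : EuclideanSpace ℝ (Fin d) → ℂ}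
    (h : MemLp (fun x => f x * (((1 + ‖x‖) ^ k)⁻¹ : ℝ)) ∞ volume) :
    ∃ C, ∀ᵐ x, ‖f x‖ ≤ C * (1 + ‖x‖) ^ k := by
  have hfin : eLpNormEssSup (fun x => f x * (((1 + ‖x‖) ^ k)⁻¹ : ℝ)) volume ≠ ⊤ := by
    rw [← eLpNorm_exponent_top]
    exact h.2.ne
  refine ⟨(eLpNormEssSup (fun x => f x * (((1 + ‖x‖) ^ k)⁻¹ : ℝ)) volume).toReal, ?_⟩
  filter_upwards [ae_le_eLpNormEssSup
    (f := fun x => f x * (((1 + ‖x‖) ^ k)⁻¹ : ℝ)) (μ := volume)] with x hx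
  have hx := ENNReal.toReal_mono hfin hx
  rw [toReal_enorm, norm_mul, Complex.norm_real, Real.norm_of_nonneg (by positivity), ← div_eq_mul_inv,
    div_le_iff₀ (by positivity)] at hx
  exact hx

/-- Wavelets nontrivial in every direction detect everything but polynomials. -/
lemma exists_polynomial_of_waveletTransform_eq_zero (d k : ℕ) (f ψ : EuclideanSpace ℝ (Fin d) → ℂ)
    (hf_loc : LocallyIntegrable f volume)
    (hf_growth : MemLp (fun x => f x * (((1 + ‖x‖) ^ k)⁻¹ : ℝ)) ∞ volume)
    (hψ_int : Integrable ψ volume)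
    (hψ_weight : Integrable (fun x => ψ x * ((1 + ‖x‖) ^ k : ℝ)) volume)
    (hψ_smooth : ContDiffOn ℝ ∞ (𝓕 ψ) {0}ᶜ)
    (hψ_nontrivial : ∀ ξ : EuclideanSpace ℝ (Fin d), ‖ξ‖ = 1 → NontrivialInDirection (𝓕 ψ) ξ)
    (hW : ∀ s : ℝ, 0 < s → ∀ t : EuclideanSpace ℝ (Fin d), waveletTransform ψ f s t = 0) :
    ∃ p : MvPolynomial (Fin d) ℂ, p.totalDegree ≤ k ∧
      f =ᵐ[volume] fun x => MvPolynomial.eval (fun i => (x i : ℂ)) p := by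
  obtain ⟨C, hC⟩ := ae_norm_le_of_memLp_top hf_growth
  have hψk : Integrable fun x => (1 + ‖x‖) ^ k * ‖ψ x‖ := by
    refine hψ_weight.norm.congr (Filter.Eventually.of_forall fun x => ?_)
    simp only [norm_mul, Complex.norm_real]
    rw [Real.norm_of_nonneg (by positivity), mul_comm]
  obtain ⟨F, hF, hfF⟩ := ae_eq_polynomial_of_fourier_supported_at_zero hf_loc hC fun g =>
    integral_mul_fourier_eq_zero_of_notMem_tsupport hf_loc.aestronglyMeasurable hC hψ_int hψk
      hψ_smooth hψ_nontrivial hW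
  obtain ⟨p, hp, rfl⟩ := mem_polyFunctionsOfDegreeLE.1 hF
  exact ⟨p, hp, hfF⟩

theorem theorem3 (d k : ℕ) (f ψ : EuclideanSpace ℝ (Fin d) → ℂ)
    (hf_loc : LocallyIntegrable f volume)
    (hf_growth : MemLp (fun x => f x * (((1 + ‖x‖) ^ k)⁻¹ : ℝ)) ∞ volume)
    (hψ_int : Integrable ψ volume)
    (hψ_weight : Integrable (fun x => ψ x * ((1 + ‖x‖) ^ k : ℝ)) volume)
    (hψ_smooth : ContDiffOn ℝ ∞ (𝓕 ψ) {0}ᶜ)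
    (hψ_nontrivial : ∀ ξ : EuclideanSpace ℝ (Fin d), ‖ξ‖ = 1 → NontrivialInDirection (𝓕 ψ) ξ)
    (hW : ∀ s : ℝ, 0 < s → ∀ t : EuclideanSpace ℝ (Fin d), waveletTransform ψ f s t = 0) :
    (∃ p : MvPolynomial (Fin d) ℂ, p.totalDegree ≤ k ∧
      f =ᵐ[volume] fun x => MvPolynomial.eval (fun i => (x i : ℂ)) p) ∧
    (MemLp f ∞ volume → ∃ c : ℂ, f =ᵐ[volume] fun _ => c) := by
  refine ⟨exists_polynomial_of_waveletTransform_eq_zero d k f ψ hf_loc hf_growth hψ_int hψ_weight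
    hψ_smooth hψ_nontrivial hW, fun hf => ?_⟩
  -- A bounded `f` satisfies the hypotheses with exponent `0`, whatever the original `k`.
  obtain ⟨p, hp, hfp⟩ := exists_polynomial_of_waveletTransform_eq_zero d 0 f ψ hf_loc
    (by simpa using hf) hψ_int (by simpa using hψ_int) hψ_smooth hψ_nontrivial hW
  refine ⟨p.coeff 0, hfp.trans (Filter.Eventually.of_forall fun x => ?_)⟩
  simp only
  conv_lhs => rw [MvPolynomial.totalDegree_eq_zero_iff_eq_C.1 (Nat.le_zero.1 hp)]
  rw [MvPolynomial.eval_C]
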